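/- **Setting.** Let $N\ge 2$, $0\ne A\in\mathbb R^{m\times n}$, $b=[b_1;\dots;b_N]\in\mathbb R^{Nm}$ and $c\in\mathbb R_+^{N-1}$ with $0<\sum_i c_i\le 1$. For a stacked vector $w=[w_1;\dots;w_N]$ put $Dw=w_N-\sum_{i<N}c_iw_i$ (likewise $Db=b_N-\sum_{i<N}c_ib_i$). All norms are Euclidean. Let $$f(w)=\sum_{i=1}^N\|Aw_i-b_i\|^2,\qquad F(w)=f(w)-\tfrac12\|ADw-Db\|^2,\qquad Q(w;\eta)=F(w)+\tfrac1{4\eta}\|Dw\|^2 .$$ A pair $(u^*,\mu^*)\in\mathbb R^{Nn}\times\mathbb R^n$ is an optimal primal–dual pair (of $\min\{F(w):w\ge0,\ Dw=0\}$) if $u^*\ge 0$, $Du^*=0$ and $\nabla F(u^*)+D^\top\mu^*\in-\mathcal N_{\ge0}(u^*)$, where $\mathcal N_{\ge 0}$ is the normal cone of the nonnegative orthant. Put $\tau=\max\{\|\mu^*\|,\sqrt{f(u^*)},\|A^\top Db\|\}$. A point $w\ge0$ is an $\eta$-optimal solution of $(P_\eta)$: $\min_{w\ge0}Q(w;\eta)$,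 if $\nabla Q(w;\eta)_j\ge-\eta$ for all coordinates $j$ and the subvector of $\nabla Q(w;\eta)$ on the coordinates $j$ with $w_j>\eta^2$ has norm at most $\eta$. **FIRM.** Let $\bar\eta=\frac{2-\sum_i c_i^2}{4\lambda_{\max}(A^\top A)}$, $\beta\ge1$, $r\in(0,1)$, $\eta_k=r^{k-1}\beta\bar\eta$ for $k\ge 1$, $u^0\in\mathbb R^{Nn}$, and a tolerance $\epsilon>0$. For $k=1,2,\dots$ as long as $\eta_k\ge\epsilon$, the $k$-th outer iteration starts from $w^0=u^{k-1}$ and runs the inner loop: $v_i=w^t_i-2\eta_kA^\top(Aw^t_i-b_i)$, $y=\sum_{i<N}c_iv_i$, $x=\frac12(y+v_N)$, $w^{t+1}_i=(v_i+c_i(x-y))_+$ for $i<N$, $w^{t+1}_N=(x)_+$; the loop stops at the first $t$ with $\|w^{t+1}-w^t\|\le\eta_k^2$, and then $u^k=w^{t+1}$. **Theorem.** For all $A,c,\beta,r$ as above and all $R$ there is a constant $C>0$, depending only on these data, such that the following holds for all $b$, all $u^0$ and all optimal primal–dual pairs $(u^*,\mu^*)$ with $\|u^0-u^*\|\le R$.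 Let $k\ge1$ be such that $\eta_k\le\bar\eta$ and the inner loops of the outer iterations $1,\dots,k-1$ terminate, after $T_0$ updates in total (for $\beta=1$ the choice $k=1$, $T_0=0$ is always possible). 1. If $\eta_k\ge\tau$, then the inner loop of outer iteration $k$ terminates after at most $C/\eta_k$ updates. 2. For every $\epsilon>0$ with $\tau\le\epsilon\le\eta_k$, FIRM with tolerance $\epsilon$ terminates after at most $T_0+C/\epsilon$ updates in total. If $\ell$ is its last outer iteration (so $\epsilon\le\eta_\ell<\epsilon/r$), its output $u^\ell$ is an $\eta_\ell$-optimal solution of $(P_{\eta_\ell})$, and $|Q(u^\ell;\eta_\ell)-F(u^*)|\le C\epsilon$. -/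

import Mathlib

open scoped BigOperators

noncomputable section

namespace FIRM

/-- Stacked vectors `w = [w_1; …; w_N]` of `N` blocks in `ℝ^p`, with the Euclidean norm of `ℝ^(Np)`. -/
abbrev Stack (N p : ℕ) : Type := PiLp 2 (fun _ : Fin N => EuclideanSpace ℝ (Fin p))

/-- The residual operator `D w = w_N - ∑_{i<N} c_i w_i`, where `N = M + 1`. -/
def D {M : ℕ} (c : Fin M → ℝ) (p : ℕ) : Stack (M + 1) p →L[ℝ] EuclideanSpace ℝ (Fin p) :=
  PiLp.proj 2 (fun _ : Fin (M + 1) => EuclideanSpace ℝ (Fin p)) (Fin.last M)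
    - ∑ i : Fin M, c i • PiLp.proj 2 (fun _ : Fin (M + 1) => EuclideanSpace ℝ (Fin p)) i.castSucc

/-- The largest eigenvalue of `Aᵀ A`. -/
def lambdaMax {m n : ℕ} (A : Matrix (Fin m) (Fin n) ℝ) : ℝ :=
  sSup (spectrum ℝ (A.transpose * A))

section Model

variable {M m n : ℕ} (A : Matrix (Fin m) (Fin n) ℝ) (c : Fin M → ℝ) (b : Stack (M + 1) m)

/-- The least squares objective `f(w) = ∑ ‖A w_i - b_i‖²`. -/
def f (w : Stack (M + 1) n) : ℝ :=
  ∑ i, ‖A.toEuclideanLin (w i) - b i‖ ^ 2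

/-- The modified objective `F(w) = f(w) - ½ ‖A D w - D b‖²`. -/
def F (w : Stack (M + 1) n) : ℝ :=
  f A b w - 1 / 2 * ‖A.toEuclideanLin (D c n w) - D c m b‖ ^ 2

/-- The quadratic penalty function `Q(w; η) = F(w) + ‖D w‖² / (4η)`. -/
def Q (η : ℝ) (w : Stack (M + 1) n) : ℝ :=
  F A c b w + 1 / (4 * η) * ‖D c n w‖ ^ 2

/-- Membership in the nonnegative orthant. -/
def Nonneg {N p : ℕ} (w : Stack N p) : Prop := ∀ i j, 0 ≤ w i j

/-- The normal cone of the nonnegative orthant at `u`. -/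
def normalCone {N p : ℕ} (u : Stack N p) : Set (Stack N p) :=
  {v | ∀ y : Stack N p, Nonneg y → inner ℝ v (y - u) ≤ 0}

/-- `(u, μ)` is an optimal primal-dual pair of `min F(w)` subject to `w ≥ 0`, `D w = 0`:
`u ≥ 0`, `D u = 0` and `∇F(u) + Dᵀ μ ∈ -N(u)`. -/
def IsOptimalPair (u : Stack (M + 1) n) (μ : EuclideanSpace ℝ (Fin n)) : Prop :=
  Nonneg u ∧ D c n u = 0 ∧
    -(gradient (F A c b) u + ContinuousLinearMap.adjoint (D c n) μ) ∈ normalCone u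

/-- The threshold `max {‖μ‖, √f(u), ‖Aᵀ D b‖}`. -/
def threshold (u : Stack (M + 1) n) (μ : EuclideanSpace ℝ (Fin n)) : ℝ :=
  max ‖μ‖ (max (Real.sqrt (f A b u)) ‖A.transpose.toEuclideanLin (D c m b)‖)

/-- `w` is an `η`-optimal solution of the penalized problem `min_{w ≥ 0} Q(w; η)`. -/
def IsEtaOptimal (η : ℝ) (w : Stack (M + 1) n) : Prop :=
  Nonneg w ∧
    Real.sqrt (∑ i, ∑ j, if η ^ 2 < w i j then (gradient (Q A c b η) w i j) ^ 2 else 0) ≤ η ∧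
    ∀ i j, -η ≤ gradient (Q A c b η) w i j

/-- Projection onto the nonnegative orthant. -/
def clip {N p : ℕ} (z : Stack N p) : Stack N p :=
  WithLp.toLp 2 fun i => WithLp.toLp 2 fun j => max (z i j) 0

/-- The local gradient steps `v_i = w_i - η g_i`, with `g_i = 2 Aᵀ (A w_i - b_i)`. -/
def localStep (η : ℝ) (w : Stack (M + 1) n) : Stack (M + 1) n :=
  WithLp.toLp 2 fun i =>
    w i - η • ((2 : ℝ) • A.transpose.toEuclideanLin (A.toEuclideanLin (w i) - b i))

/-- The vector operations at the server: `y = ∑_{i<N} c_i v_i`, `x = ½ (y + v_N)`,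
`z_i = v_i + c_i (x - y)` for `i < N`, `z_N = x`, and the result is `z` clipped at `0`. -/
def serverStep {p : ℕ} (v : Stack (M + 1) p) : Stack (M + 1) p :=
  let y : EuclideanSpace ℝ (Fin p) := ∑ i : Fin M, c i • v i.castSucc
  let x : EuclideanSpace ℝ (Fin p) := (1 / 2 : ℝ) • (y + v (Fin.last M))
  clip (WithLp.toLp 2
    (Fin.lastCases (motive := fun _ => EuclideanSpace ℝ (Fin p)) x
      (fun i : Fin M => v i.castSucc + c i • (x - y))))

/-- One execution of the FIRM update with step size `η`. -/
def step (η : ℝ) (w : Stack (M + 1) n) : Stack (M + 1) n :=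
  serverStep c (localStep A b η w)

/-- The inner loop with parameter `η`, started at `w`, stops after exactly `T` executions of the
update and returns `w'`: with `w^t` the iterates, `t = T - 1` is the first index with
`‖w^{t+1} - w^t‖ ≤ η²`, and `w' = w^{t+1}`. -/
def InnerLoop (η : ℝ) (w w' : Stack (M + 1) n) (T : ℕ) : Prop :=
  ∃ t : ℕ, T = t + 1 ∧ w' = (step A c b η)^[t + 1] w ∧
    ‖(step A c b η)^[t + 1] w - (step A c b η)^[t] w‖ ≤ η ^ 2 ∧
    ∀ s < t, η ^ 2 < ‖(step A c b η)^[s + 1] w - (step A c b η)^[s] w‖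

/-- The bound `(2 - ∑ c_i²) / (4 λ_max(Aᵀ A))` on the step size. -/
def stepBound : ℝ := (2 - ∑ i, c i ^ 2) / (4 * lambdaMax A)

/-- The parameter `η_{k+1} = r^k η_1` of the outer iteration number `k + 1` (that is, after `k`
completed ones), where `η_1 = β (2 - ∑ c_i²) / (4 λ_max(Aᵀ A))`. -/
def eta (β r : ℝ) (k : ℕ) : ℝ := r ^ k * (β * stepBound A c)

/-- FIRM started at `u0` completes its first `K` outer iterations; `u k` is the iterate after `k`
outer iterations, and the inner loop of outer iteration `k + 1` takes `T k` executions of the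
update. -/
def Run (β r : ℝ) (u0 : Stack (M + 1) n) (K : ℕ) (u : ℕ → Stack (M + 1) n) (T : ℕ → ℕ) : Prop :=
  u 0 = u0 ∧ ∀ k < K, InnerLoop A c b (eta A c β r k) (u k) (u (k + 1)) (T k)

end Model

end FIRM

end

noncomputable section

namespace FIRM

/-! ### Coordinates of stacked vectors -/

lemma stack_inner_eq {N p : ℕ} (x y : Stack N p) :
    inner ℝ x y = ∑ i, ∑ j, x i j * y i j := by
  rw [PiLp.inner_apply]
  refine Finset.sum_congr rfl fun i _ => ?_
  rw [PiLp.inner_apply]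
  refine Finset.sum_congr rfl fun j _ => ?_
  simp [mul_comm]

lemma stack_norm_sq_eq {N p : ℕ} (x : Stack N p) : ‖x‖ ^ 2 = ∑ i, ∑ j, x i j ^ 2 := by
  rw [← real_inner_self_eq_norm_sq, stack_inner_eq]
  simp [sq]

lemma abs_coord_le_norm {N p : ℕ} (x : Stack N p) (i : Fin N) (j : Fin p) : |x i j| ≤ ‖x‖ :=
  (PiLp.norm_apply_le (x i) j).trans (PiLp.norm_apply_le x i)

lemma continuous_coord {N p : ℕ} (i : Fin N) (j : Fin p) :
    Continuous fun x : Stack N p => x i j := by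
  fun_prop

/-! ### Hoffman's error bound on the nonnegative orthant -/

/-- The closed face of an orthant given by a sign pattern. -/
def signFace {N p : ℕ} (σ : Fin N → Fin p → SignType) : Set (Stack N p) :=
  {v | ∀ i j, 0 ≤ v i j * (σ i j : ℝ) ∧ (σ i j = 0 → v i j = 0)}

lemma isClosed_signFace {N p : ℕ} (σ : Fin N → Fin p → SignType) : IsClosed (signFace σ) := by
  have h : signFace σ = ⋂ i, ⋂ j, {v : Stack N p | 0 ≤ v i j * (σ i j : ℝ)} ∩
      {v | σ i j = 0 → v i j = 0} := by
    ext v; simp [signFace]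
  rw [h]
  refine isClosed_iInter fun i => isClosed_iInter fun j => IsClosed.inter ?_ ?_
  · exact isClosed_le continuous_const ((continuous_coord i j).mul continuous_const)
  · by_cases hσ : σ i j = 0
    · simpa [hσ] using isClosed_eq (continuous_coord i j) continuous_const
    · simp [hσ]

lemma smul_mem_signFace {N p : ℕ} {σ : Fin N → Fin p → SignType} {v : Stack N p}
    (hv : v ∈ signFace σ) {a : ℝ} (ha : 0 ≤ a) : a • v ∈ signFace σ := by
  intro i j
  refine ⟨?_, fun h => ?_⟩
  · have := mul_nonneg ha (hv i j).1
    simpa [mul_assoc] using this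
  · simp [(hv i j).2 h]

lemma signFace_bound {N p : ℕ} {G : Type*} [NormedAddCommGroup G] [NormedSpace ℝ G]
    (B : Stack N p →L[ℝ] G) (σ : Fin N → Fin p → SignType)
    (h0 : ∀ v ∈ signFace σ, B v = 0 → v = 0) :
    ∃ κ : ℝ, 0 ≤ κ ∧ ∀ v ∈ signFace σ, ‖v‖ ≤ κ * ‖B v‖ := by
  have hK : IsCompact (signFace σ ∩ Metric.sphere (0 : Stack N p) 1) :=
    (isCompact_sphere _ _).inter_left (isClosed_signFace σ)
  rcases (signFace σ ∩ Metric.sphere (0 : Stack N p) 1).eq_empty_or_nonempty with he | hne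
  · refine ⟨0, le_rfl, fun v hv => ?_⟩
    by_contra hlt
    have hv0 : ‖v‖ ≠ 0 := by intro h; simp [h] at hlt
    have : ‖v‖⁻¹ • v ∈ signFace σ ∩ Metric.sphere (0 : Stack N p) 1 :=
      ⟨smul_mem_signFace hv (by positivity), by simp [norm_smul, hv0]⟩
    simp [he] at this
  · obtain ⟨x, hx, hmin⟩ := hK.exists_isMinOn hne (B.continuous.norm.continuousOn)
    have hx1 : ‖x‖ = 1 := by simpa using hx.2
    have hBx : 0 < ‖B x‖ := by
      rw [norm_pos_iff]
      intro h
      have := h0 x hx.1 h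
      simp [this] at hx1
    refine ⟨‖B x‖⁻¹, by positivity, fun v hv => ?_⟩
    by_cases hv0 : ‖v‖ = 0
    · rw [hv0]; positivity
    have hv' : 0 < ‖v‖ := lt_of_le_of_ne (norm_nonneg _) (Ne.symm hv0)
    have hmem : ‖v‖⁻¹ • v ∈ signFace σ ∩ Metric.sphere (0 : Stack N p) 1 :=
      ⟨smul_mem_signFace hv (by positivity), by simp [norm_smul, hv0]⟩
    have h1 : ‖B x‖ ≤ ‖B (‖v‖⁻¹ • v)‖ := hmin hmem
    rw [map_smul, norm_smul, norm_inv, norm_norm] at h1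
    rw [inv_mul_eq_div, le_div_iff₀ hBx]
    calc ‖v‖ * ‖B x‖ ≤ ‖v‖ * (‖v‖⁻¹ * ‖B v‖) := by gcongr
      _ = ‖B v‖ := by field_simp

lemma exists_conformal_step {N p : ℕ} {z v : Stack N p}
    (hv : v ∈ signFace fun i j => SignType.sign (z i j)) :
    ∃ t : ℝ, 0 < t ∧ ∀ i j, |t * v i j| ≤ |z i j| := by
  have key : ∀ q : Fin N × Fin p, ∃ t : ℝ, 0 < t ∧ |t * v q.1 q.2| ≤ |z q.1 q.2| := by
    rintro ⟨i, j⟩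
    by_cases hz : z i j = 0
    · refine ⟨1, one_pos, ?_⟩
      have := (hv i j).2 (by simp [hz])
      simp [this]
    · have hz' : 0 < |z i j| := abs_pos.2 hz
      refine ⟨|z i j| / (|v i j| + 1), by positivity, ?_⟩
      rw [abs_mul, abs_of_pos (by positivity : 0 < |z i j| / (|v i j| + 1)), div_mul_eq_mul_div,
        div_le_iff₀ (by positivity)]
      nlinarith [abs_nonneg (v i j)]
  choose t ht htv using key
  obtain ⟨a, ha, hat⟩ : ∃ a : ℝ, 0 < a ∧ ∀ q, a ≤ t q := by
    rcases isEmpty_or_nonempty (Fin N × Fin p) with h | h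
    · exact ⟨1, one_pos, fun q => h.elim q⟩
    · obtain ⟨q, hq⟩ := Finite.exists_min t
      exact ⟨t q, ht q, hq⟩
  refine ⟨a, ha, fun i j => le_trans ?_ (htv (i, j))⟩
  rw [abs_mul, abs_mul, abs_of_pos ha, abs_of_pos (ht _)]
  exact mul_le_mul_of_nonneg_right (hat _) (abs_nonneg _)

theorem hoffman_orthant {N p : ℕ} {G : Type*} [NormedAddCommGroup G] [NormedSpace ℝ G]
    (B : Stack N p →L[ℝ] G) :
    ∃ κ : ℝ, 0 < κ ∧ ∀ w u : Stack N p, Nonneg w → Nonneg u →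
      ∃ q : Stack N p, Nonneg q ∧ B q = B u ∧ ‖w - q‖ ≤ κ * ‖B (w - u)‖ := by
  classical
  have hex : ∀ σ : Fin N → Fin p → SignType, ∃ κ : ℝ, 0 ≤ κ ∧
      ((∀ v ∈ signFace σ, B v = 0 → v = 0) → ∀ v ∈ signFace σ, ‖v‖ ≤ κ * ‖B v‖) := by
    intro σ
    by_cases h : ∀ v ∈ signFace σ, B v = 0 → v = 0
    · obtain ⟨κ, hκ, hb⟩ := signFace_bound B σ h
      exact ⟨κ, hκ, fun _ => hb⟩
    · exact ⟨0, le_rfl, fun h' => absurd h' h⟩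
  choose κ hκ0 hκ using hex
  refine ⟨1 + ∑ σ, κ σ, by have := Finset.sum_nonneg fun σ (_ : σ ∈ Finset.univ) => hκ0 σ; linarith,
    fun w u hw hu => ?_⟩
  let S : Set (Stack N p) := {q | Nonneg q ∧ B q = B u}
  have hS : IsClosed S := by
    have : S = (⋂ i, ⋂ j, {q : Stack N p | 0 ≤ q i j}) ∩ {q | B q = B u} := by
      ext q; simp [S, Nonneg]
    rw [this]
    exact (isClosed_iInter fun i => isClosed_iInter fun j =>
      isClosed_le continuous_const (continuous_coord i j)).inter
      (isClosed_eq B.continuous continuous_const)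
  obtain ⟨q, hq, hdist⟩ := hS.exists_infDist_eq_dist ⟨u, hu, rfl⟩ w
  have hmin : ∀ q' ∈ S, ‖w - q‖ ≤ ‖w - q'‖ := by
    intro q' hq'
    rw [← dist_eq_norm, ← dist_eq_norm, ← hdist]
    exact Metric.infDist_le_dist_of_mem hq'
  refine ⟨q, hq.1, hq.2, ?_⟩
  set z : Stack N p := q - w with hz
  have hzij : ∀ i j, z i j = q i j - w i j := fun i j => by simp [hz]
  set σ : Fin N → Fin p → SignType := fun i j => SignType.sign (z i j) with hσ
  have hσ0 : ∀ v ∈ signFace σ, B v = 0 → v = 0 := by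
    intro v hv hBv
    obtain ⟨t, ht, htv⟩ := exists_conformal_step hv
    have hsame : ∀ i j, 0 ≤ v i j * z i j := by
      intro i j
      have h1 := (hv i j).1
      have : z i j = (σ i j : ℝ) * |z i j| := (sign_mul_abs (z i j)).symm
      rw [this, ← mul_assoc]
      exact mul_nonneg h1 (abs_nonneg _)
    have hmem : q - t • v ∈ S := by
      refine ⟨fun i j => ?_, by simp [hq.2, hBv]⟩
      have e : (q - t • v) i j = q i j - t * v i j := by simp
      rw [e]
      have h1 := htv i j
      have h2 := hsame i j
      have h3 := hzij i j
      have h4 := hq.1 i j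
      have h5 := hw i j
      rcases le_total 0 (z i j) with h | h
      · rw [abs_of_nonneg h] at h1
        have := (abs_le.1 h1).2
        linarith
      · rw [abs_of_nonpos h] at h1
        rcases h.lt_or_eq with h | h
        · have : v i j ≤ 0 := by nlinarith
          nlinarith
        · have := (abs_le.1 h1).2
          linarith
    have hle := hmin _ hmem
    have h1 : ‖w - q‖ ^ 2 ≤ ‖w - (q - t • v)‖ ^ 2 := by gcongr
    have e1 : w - q = -z := by simp [hz]
    have e2 : w - (q - t • v) = -(z - t • v) := by simp [hz]; abel
    rw [e1, e2, norm_neg, norm_neg, norm_sub_sq_real z (t • v), inner_smul_right, norm_smul,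
      Real.norm_of_nonneg ht.le] at h1
    have h2 : t * ‖v‖ ^ 2 ≤ inner ℝ z v := by
      rw [stack_norm_sq_eq, stack_inner_eq, Finset.mul_sum]
      refine Finset.sum_le_sum fun i _ => ?_
      rw [Finset.mul_sum]
      refine Finset.sum_le_sum fun j _ => ?_
      have h1 := htv i j
      have h2 := hsame i j
      rw [abs_mul, abs_of_pos ht] at h1
      calc t * v i j ^ 2 = t * |v i j| * |v i j| := by rw [mul_assoc, ← sq, sq_abs]
        _ ≤ |z i j| * |v i j| := by gcongr
        _ = z i j * v i j := by rw [← abs_mul, abs_of_nonneg (by linarith)]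
    have h3 : t * (t * ‖v‖ ^ 2) ≤ t * inner ℝ z v := by gcongr
    have h4 : t ^ 2 * ‖v‖ ^ 2 ≤ 0 := by nlinarith
    have h5 : ‖v‖ ^ 2 ≤ 0 := by
      by_contra hlt
      have : 0 < t ^ 2 * ‖v‖ ^ 2 := by push Not at hlt; positivity
      linarith
    have h6 : ‖v‖ = 0 := by nlinarith [norm_nonneg v]
    simpa using h6
  have hzmem : z ∈ signFace σ := by
    intro i j
    refine ⟨?_, fun h => by simpa [hσ] using h⟩
    rw [mul_comm]
    simp only [hσ, sign_mul_self]
    exact abs_nonneg _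
  have hb := hκ σ hσ0 z hzmem
  have hBz : ‖B z‖ = ‖B (w - u)‖ := by
    rw [hz, map_sub, map_sub, hq.2, norm_sub_rev]
  rw [norm_sub_rev, ← hz, ← hBz]
  refine hb.trans (mul_le_mul_of_nonneg_right ?_ (norm_nonneg _))
  have := Finset.single_le_sum (fun σ _ => hκ0 σ) (Finset.mem_univ σ)
  linarith

/-! ### The largest eigenvalue -/

section LambdaMax

variable {m n : ℕ} (A : Matrix (Fin m) (Fin n) ℝ)

lemma isHermitian_gram : (A.transpose * A).IsHermitian := by
  have := Matrix.isHermitian_conjTranspose_mul_self A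
  rwa [Matrix.conjTranspose_eq_transpose_of_trivial] at this

lemma norm_sq_toEuclideanLin (x : EuclideanSpace ℝ (Fin n)) :
    ‖A.toEuclideanLin x‖ ^ 2 = x.ofLp ⬝ᵥ ((A.transpose * A).mulVec x.ofLp) := by
  rw [← real_inner_self_eq_norm_sq, EuclideanSpace.inner_eq_star_dotProduct]
  simp only [Matrix.ofLp_toLpLin, Matrix.toLin'_apply, star_trivial]
  rw [← Matrix.mulVec_mulVec, Matrix.mulVec_transpose, Matrix.dotProduct_mulVec, dotProduct_comm]

lemma norm_sq_toEuclideanLin_le (x : EuclideanSpace ℝ (Fin n)) :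
    ‖A.toEuclideanLin x‖ ^ 2 ≤ lambdaMax A * ‖x‖ ^ 2 := by
  have hH := isHermitian_gram A
  have hbdd : BddAbove (spectrum ℝ (A.transpose * A)) := by
    rw [hH.spectrum_real_eq_range_eigenvalues]
    exact (Set.finite_range _).bddAbove
  have hherm : (algebraMap ℝ (Matrix (Fin n) (Fin n) ℝ) (lambdaMax A) - A.transpose * A).IsHermitian := by
    refine Matrix.IsHermitian.sub ?_ hH
    rw [Matrix.algebraMap_eq_diagonal]
    exact Matrix.isHermitian_diagonal _
  have hpsd : (algebraMap ℝ (Matrix (Fin n) (Fin n) ℝ) (lambdaMax A) - A.transpose * A).PosSemidef := by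
    rw [hherm.posSemidef_iff_eigenvalues_nonneg]
    intro i
    have hmem : hherm.eigenvalues i ∈ spectrum ℝ
        (algebraMap ℝ (Matrix (Fin n) (Fin n) ℝ) (lambdaMax A) - A.transpose * A) := by
      rw [hherm.spectrum_real_eq_range_eigenvalues]
      exact ⟨i, rfl⟩
    rw [← spectrum.singleton_sub_eq] at hmem
    obtain ⟨a, ha, y, hy, hxy⟩ := hmem
    have h1 : y ≤ lambdaMax A := le_csSup hbdd hy
    simp only [Set.mem_singleton_iff] at ha
    simp only [Pi.zero_apply]
    rw [← hxy, ha]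
    simpa using h1
  have h := hpsd.dotProduct_mulVec_nonneg x.ofLp
  rw [Matrix.sub_mulVec, dotProduct_sub, star_trivial, ← norm_sq_toEuclideanLin,
    Algebra.algebraMap_eq_smul_one, Matrix.smul_mulVec, Matrix.one_mulVec, dotProduct_smul] at h
  have e : x.ofLp ⬝ᵥ x.ofLp = ‖x‖ ^ 2 := by
    rw [← real_inner_self_eq_norm_sq, EuclideanSpace.inner_eq_star_dotProduct, star_trivial]
  rw [e, smul_eq_mul] at h
  linarith

lemma lambdaMax_pos (hA : A ≠ 0) : 0 < lambdaMax A := by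
  by_contra hle
  push Not at hle
  apply hA
  apply Matrix.toEuclideanLin.injective
  ext1 x
  have h := norm_sq_toEuclideanLin_le A x
  have : lambdaMax A * ‖x‖ ^ 2 ≤ 0 := mul_nonpos_of_nonpos_of_nonneg hle (by positivity)
  have h0 : ‖A.toEuclideanLin x‖ = 0 := by nlinarith [norm_nonneg (A.toEuclideanLin x)]
  simpa using h0

end LambdaMax

/-! ### The block operator and the adjoint of `D` -/

/-- The block diagonal operator `w ↦ [A w_1; …; A w_N]` as a linear map. -/
def blockLin {m n : ℕ} (N : ℕ) (A : Matrix (Fin m) (Fin n) ℝ) : Stack N n →ₗ[ℝ] Stack N m where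
  toFun w := WithLp.toLp 2 fun i => A.toEuclideanLin (w i)
  map_add' x y := by
    ext1 i
    exact map_add A.toEuclideanLin (x i) (y i)
  map_smul' a x := by
    ext1 i
    exact map_smul A.toEuclideanLin a (x i)

/-- The block diagonal operator `w ↦ [A w_1; …; A w_N]`. -/
def blockMap {m n : ℕ} (N : ℕ) (A : Matrix (Fin m) (Fin n) ℝ) : Stack N n →L[ℝ] Stack N m where
  toLinearMap := blockLin N A
  cont := by
    refine (PiLp.continuous_toLp 2 _).comp (continuous_pi fun i => ?_)
    have hA : Continuous A.toEuclideanLin := LinearMap.continuous_of_finiteDimensional _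
    exact hA.comp (PiLp.continuous_apply 2 _ i)

@[simp] lemma blockMap_apply {m n N : ℕ} (A : Matrix (Fin m) (Fin n) ℝ) (w : Stack N n)
    (i : Fin N) : blockMap N A w i = A.toEuclideanLin (w i) := rfl

lemma inner_toEuclideanLin {m n : ℕ} (A : Matrix (Fin m) (Fin n) ℝ)
    (x : EuclideanSpace ℝ (Fin n)) (y : EuclideanSpace ℝ (Fin m)) :
    inner ℝ (A.toEuclideanLin x) y = inner ℝ x (A.transpose.toEuclideanLin y) := by
  rw [EuclideanSpace.inner_eq_star_dotProduct, EuclideanSpace.inner_eq_star_dotProduct]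
  simp only [Matrix.ofLp_toLpLin, Matrix.toLin'_apply, star_trivial]
  rw [Matrix.mulVec_transpose, Matrix.dotProduct_mulVec]

lemma inner_blockMap {m n N : ℕ} (A : Matrix (Fin m) (Fin n) ℝ) (x : Stack N n) (y : Stack N m) :
    inner ℝ (blockMap N A x) y = inner ℝ x (blockMap N A.transpose y) := by
  rw [PiLp.inner_apply, PiLp.inner_apply]
  exact Finset.sum_congr rfl fun i _ => by simp [inner_toEuclideanLin]

lemma norm_sq_blockMap_le {m n N : ℕ} (A : Matrix (Fin m) (Fin n) ℝ) (x : Stack N n) :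
    ‖blockMap N A x‖ ^ 2 ≤ lambdaMax A * ‖x‖ ^ 2 := by
  rw [PiLp.norm_sq_eq_of_L2, PiLp.norm_sq_eq_of_L2, Finset.mul_sum]
  exact Finset.sum_le_sum fun i _ => norm_sq_toEuclideanLin_le A (x i)

section Residual

variable {M : ℕ} (c : Fin M → ℝ)

lemma D_apply (p : ℕ) (w : Stack (M + 1) p) :
    D c p w = w (Fin.last M) - ∑ i : Fin M, c i • w i.castSucc := by
  simp [D]

lemma D_blockMap {m n : ℕ} (A : Matrix (Fin m) (Fin n) ℝ) (w : Stack (M + 1) n) :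
    D c m (blockMap (M + 1) A w) = A.toEuclideanLin (D c n w) := by
  simp [D_apply]

/-- The explicit adjoint of `D`. -/
def Dadj (p : ℕ) (e : EuclideanSpace ℝ (Fin p)) : Stack (M + 1) p :=
  WithLp.toLp 2 (Fin.lastCases (motive := fun _ => EuclideanSpace ℝ (Fin p)) e
    fun i => -(c i • e))

@[simp] lemma Dadj_last (p : ℕ) (e : EuclideanSpace ℝ (Fin p)) :
    Dadj c p e (Fin.last M) = e := by simp [Dadj]

@[simp] lemma Dadj_castSucc (p : ℕ) (e : EuclideanSpace ℝ (Fin p)) (i : Fin M) :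
    Dadj c p e i.castSucc = -(c i • e) := by simp [Dadj]

lemma inner_Dadj (p : ℕ) (x : Stack (M + 1) p) (e : EuclideanSpace ℝ (Fin p)) :
    inner ℝ (D c p x) e = inner ℝ x (Dadj c p e) := by
  rw [PiLp.inner_apply x, Fin.sum_univ_castSucc, D_apply, inner_sub_left, sum_inner]
  simp [inner_neg_right, inner_smul_left, inner_smul_right]
  ring

lemma adjoint_D (p : ℕ) (e : EuclideanSpace ℝ (Fin p)) :
    ContinuousLinearMap.adjoint (D c p) e = Dadj c p e := by
  refine ext_inner_left ℝ fun x => ?_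
  rw [ContinuousLinearMap.adjoint_inner_right, inner_Dadj]

lemma Dadj_sub (p : ℕ) (e e' : EuclideanSpace ℝ (Fin p)) :
    Dadj c p (e - e') = Dadj c p e - Dadj c p e' := by
  simp [← adjoint_D]

lemma Dadj_smul (p : ℕ) (a : ℝ) (e : EuclideanSpace ℝ (Fin p)) :
    Dadj c p (a • e) = a • Dadj c p e := by
  simp [← adjoint_D]

lemma blockMap_Dadj {m n : ℕ} (A : Matrix (Fin m) (Fin n) ℝ) (e : EuclideanSpace ℝ (Fin n)) :
    blockMap (M + 1) A (Dadj c n e) = Dadj c m (A.toEuclideanLin e) := by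
  ext1 i
  refine Fin.lastCases ?_ (fun i => ?_) i <;> simp

lemma D_Dadj (p : ℕ) (e : EuclideanSpace ℝ (Fin p)) :
    D c p (Dadj c p e) = (1 + ∑ i, c i ^ 2) • e := by
  rw [D_apply]
  simp only [Dadj_last, Dadj_castSucc, smul_neg, Finset.sum_neg_distrib, sub_neg_eq_add, add_smul,
    one_smul, Finset.sum_smul, smul_smul, sq]

lemma norm_sq_Dadj (p : ℕ) (e : EuclideanSpace ℝ (Fin p)) :
    ‖Dadj c p e‖ ^ 2 = (1 + ∑ i, c i ^ 2) * ‖e‖ ^ 2 := by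
  rw [← real_inner_self_eq_norm_sq, ← inner_Dadj, D_Dadj, inner_smul_left,
    real_inner_self_eq_norm_sq]
  simp

variable {c}

lemma sum_sq_le_one (hc : ∀ i, 0 ≤ c i) (hc_le : ∑ i, c i ≤ 1) : ∑ i, c i ^ 2 ≤ 1 := by
  refine le_trans (Finset.sum_le_sum fun i _ => ?_) hc_le
  have : c i ≤ 1 := (Finset.single_le_sum (fun i _ => hc i) (Finset.mem_univ i)).trans hc_le
  nlinarith [hc i]

lemma norm_sq_D_le (hs : ∑ i, c i ^ 2 ≤ 1) (p : ℕ) (x : Stack (M + 1) p) :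
    ‖D c p x‖ ^ 2 ≤ 2 * ‖x‖ ^ 2 := by
  have h : 0 ≤ ‖(2 : ℝ) • x - Dadj c p (D c p x)‖ ^ 2 := by positivity
  rw [norm_sub_sq_real, inner_smul_left, ← inner_Dadj, norm_sq_Dadj, real_inner_self_eq_norm_sq,
    norm_smul] at h
  simp at h
  nlinarith [sq_nonneg ‖D c p x‖]

end Residual

/-! ### The penalty function as a quadratic -/

section Quadratic

variable {M m n : ℕ} (A : Matrix (Fin m) (Fin n) ℝ) (c : Fin M → ℝ) (b : Stack (M + 1) m)

/-- The gradient of `F`. -/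
def gradF (w : Stack (M + 1) n) : Stack (M + 1) n :=
  (2 : ℝ) • blockMap (M + 1) A.transpose (blockMap (M + 1) A w - b)
    - blockMap (M + 1) A.transpose (Dadj c m (D c m (blockMap (M + 1) A w - b)))

/-- The gradient of `Q(·; η)`. -/
def gradQ (η : ℝ) (w : Stack (M + 1) n) : Stack (M + 1) n :=
  gradF A c b w + (1 / (2 * η)) • Dadj c n (D c n w)

/-- The Hessian of `Q(·; η)` applied to `h`. -/
def hessQ (η : ℝ) (h : Stack (M + 1) n) : Stack (M + 1) n :=
  gradQ A c 0 η h

/-- The second order part of `F`. -/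
def quadF (h : Stack (M + 1) n) : ℝ :=
  ‖blockMap (M + 1) A h‖ ^ 2 - 1 / 2 * ‖D c m (blockMap (M + 1) A h)‖ ^ 2

/-- The second order part of `Q(·; η)`. -/
def quadQ (η : ℝ) (h : Stack (M + 1) n) : ℝ :=
  quadF A c h + 1 / (4 * η) * ‖D c n h‖ ^ 2

lemma f_eq (w : Stack (M + 1) n) : f A b w = ‖blockMap (M + 1) A w - b‖ ^ 2 := by
  rw [f, PiLp.norm_sq_eq_of_L2]
  rfl

lemma F_eq (w : Stack (M + 1) n) :
    F A c b w = ‖blockMap (M + 1) A w - b‖ ^ 2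
      - 1 / 2 * ‖D c m (blockMap (M + 1) A w - b)‖ ^ 2 := by
  rw [F, f_eq, map_sub, D_blockMap]

lemma inner_gradF (w h : Stack (M + 1) n) :
    inner ℝ (gradF A c b w) h = 2 * inner ℝ (blockMap (M + 1) A w - b) (blockMap (M + 1) A h)
      - inner ℝ (D c m (blockMap (M + 1) A w - b)) (D c m (blockMap (M + 1) A h)) := by
  rw [real_inner_comm, gradF, inner_sub_right, inner_smul_right, ← inner_blockMap,
    ← inner_blockMap, ← inner_Dadj, real_inner_comm, real_inner_comm (D c m (blockMap (M + 1) A h))]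

lemma inner_gradQ (η : ℝ) (w h : Stack (M + 1) n) :
    inner ℝ (gradQ A c b η w) h = inner ℝ (gradF A c b w) h
      + 1 / (2 * η) * inner ℝ (D c n w) (D c n h) := by
  rw [gradQ, inner_add_left, inner_smul_left, real_inner_comm h (Dadj c n _), ← inner_Dadj,
    real_inner_comm (D c n h)]
  simp

lemma F_add (w h : Stack (M + 1) n) :
    F A c b (w + h) = F A c b w + inner ℝ (gradF A c b w) h + quadF A c h := by
  have e : blockMap (M + 1) A (w + h) - b = (blockMap (M + 1) A w - b) + blockMap (M + 1) A h := by
    rw [map_add]; abel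
  rw [F_eq, F_eq, e, map_add (D c m), norm_add_sq_real, norm_add_sq_real, inner_gradF, quadF]
  ring

lemma Q_add (η : ℝ) (w h : Stack (M + 1) n) :
    Q A c b η (w + h) = Q A c b η w + inner ℝ (gradQ A c b η w) h + quadQ A c η h := by
  rw [Q, Q, F_add, map_add, norm_add_sq_real, inner_gradQ, quadQ]
  by_cases hη : η = 0
  · simp [hη]
  · field_simp
    ring

lemma gradQ_add (η : ℝ) (w h : Stack (M + 1) n) :
    gradQ A c b η (w + h) = gradQ A c b η w + hessQ A c η h := by
  refine ext_inner_right ℝ fun x => ?_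
  rw [inner_add_left, hessQ, inner_gradQ, inner_gradQ, inner_gradQ, inner_gradF, inner_gradF,
    inner_gradF]
  simp only [map_add, map_sub, inner_add_left, inner_sub_left, map_zero, inner_zero_left]
  ring

lemma inner_hessQ (η : ℝ) (x y : Stack (M + 1) n) :
    inner ℝ (hessQ A c η x) y = 2 * inner ℝ (blockMap (M + 1) A x) (blockMap (M + 1) A y)
      - inner ℝ (D c m (blockMap (M + 1) A x)) (D c m (blockMap (M + 1) A y))
      + 1 / (2 * η) * inner ℝ (D c n x) (D c n y) := by
  rw [hessQ, inner_gradQ, inner_gradF]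
  simp

lemma inner_hessQ_self (η : ℝ) (x : Stack (M + 1) n) :
    inner ℝ (hessQ A c η x) x = 2 * quadQ A c η x := by
  rw [inner_hessQ, quadQ, quadF]
  simp only [real_inner_self_eq_norm_sq]
  by_cases hη : η = 0
  · simp [hη]; ring
  · field_simp
    ring

lemma inner_hessQ_comm (η : ℝ) (x y : Stack (M + 1) n) :
    inner ℝ (hessQ A c η x) y = inner ℝ x (hessQ A c η y) := by
  rw [real_inner_comm _ x, inner_hessQ, inner_hessQ]
  simp only [real_inner_comm]

lemma quadQ_sub (η : ℝ) (x y : Stack (M + 1) n) :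
    quadQ A c η (x - y) = quadQ A c η x - inner ℝ x (hessQ A c η y) + quadQ A c η y := by
  have h1 := inner_hessQ_self A c η (x - y)
  have hsub : hessQ A c η (x - y) = hessQ A c η x - hessQ A c η y := by
    have := gradQ_add A c 0 η y (x - y)
    rw [add_sub_cancel] at this
    simp only [hessQ] at this ⊢
    rw [this]; abel
  rw [hsub, inner_sub_left, inner_sub_right, inner_sub_right, inner_hessQ_self, inner_hessQ_self,
    inner_hessQ_comm, real_inner_comm x (hessQ A c η y)] at h1
  linarith

lemma hasGradientAt_of_sq_bound {H : Type*} [NormedAddCommGroup H] [InnerProductSpace ℝ H]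
    [CompleteSpace H] {φ : H → ℝ} {x g : H} {C : ℝ}
    (h : ∀ d, |φ (x + d) - φ x - inner ℝ g d| ≤ C * ‖d‖ ^ 2) : HasGradientAt φ g x := by
  rw [hasGradientAt_iff_isLittleO]
  have h1 : (fun x' => φ x' - φ x - inner ℝ g (x' - x)) =O[nhds x] fun x' => ‖x' - x‖ ^ 2 := by
    refine Asymptotics.IsBigO.of_bound C (Filter.Eventually.of_forall fun x' => ?_)
    have := h (x' - x)
    rw [add_sub_cancel] at this
    simpa using this
  refine h1.trans_isLittleO ?_
  exact Asymptotics.isLittleO_pow_sub_sub x (by norm_num)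

variable {A c} in
lemma quadF_nonneg (hs : ∑ i, c i ^ 2 ≤ 1) (h : Stack (M + 1) n) : 0 ≤ quadF A c h := by
  have := norm_sq_D_le hs m (blockMap (M + 1) A h)
  rw [quadF]
  linarith

variable {A c} in
lemma quadF_le (h : Stack (M + 1) n) : quadF A c h ≤ lambdaMax A * ‖h‖ ^ 2 := by
  have := norm_sq_blockMap_le A h
  rw [quadF]
  nlinarith [sq_nonneg ‖D c m (blockMap (M + 1) A h)‖]

variable {A c} in
lemma quadQ_nonneg (hs : ∑ i, c i ^ 2 ≤ 1) {η : ℝ} (hη : 0 < η) (h : Stack (M + 1) n) :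
    0 ≤ quadQ A c η h := by
  have := quadF_nonneg (A := A) hs h
  rw [quadQ]
  positivity

variable {A c} in
lemma gradient_F (hs : ∑ i, c i ^ 2 ≤ 1) (w : Stack (M + 1) n) :
    gradient (F A c b) w = gradF A c b w := by
  refine (hasGradientAt_of_sq_bound (C := lambdaMax A) fun d => ?_).gradient
  have e : F A c b (w + d) - F A c b w - inner ℝ (gradF A c b w) d = quadF A c d := by
    rw [F_add]; ring
  rw [e, abs_of_nonneg (quadF_nonneg hs d)]
  exact quadF_le d

variable {A c} in
lemma gradient_Q (hs : ∑ i, c i ^ 2 ≤ 1) {η : ℝ} (hη : 0 < η) (w : Stack (M + 1) n) :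
    gradient (Q A c b η) w = gradQ A c b η w := by
  refine (hasGradientAt_of_sq_bound (C := lambdaMax A + 1 / (4 * η) * 2) fun d => ?_).gradient
  have e : Q A c b η (w + d) - Q A c b η w - inner ℝ (gradQ A c b η w) d = quadQ A c η d := by
    rw [Q_add]; ring
  rw [e, abs_of_nonneg (quadQ_nonneg hs hη d), quadQ, add_mul, mul_assoc]
  gcongr
  · exact quadF_le d
  · exact norm_sq_D_le hs n d

variable {A c} in
/-- The step size bound makes `η` at most the inverse Lipschitz constant of the gradient. -/
lemma quadQ_le (hs : ∑ i, c i ^ 2 ≤ 1) {η : ℝ} (hη : 0 < η) (hηA : 2 * η * lambdaMax A ≤ 1)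
    (h : Stack (M + 1) n) : quadQ A c η h ≤ 1 / (2 * η) * ‖h‖ ^ 2 := by
  set e := D c n h with he
  set s := ∑ i, c i ^ 2 with hs'
  have h1 := norm_sq_blockMap_le A (h - (1 / 2 : ℝ) • Dadj c n e)
  have h2 := norm_sq_toEuclideanLin_le A e
  rw [map_sub, map_smul, blockMap_Dadj, norm_sub_sq_real, norm_sub_sq_real, inner_smul_right,
    inner_smul_right, ← inner_Dadj, ← inner_Dadj, D_blockMap, ← he, real_inner_self_eq_norm_sq,
    real_inner_self_eq_norm_sq, norm_smul, norm_smul, mul_pow, mul_pow, norm_sq_Dadj,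
    norm_sq_Dadj, ← hs'] at h1
  norm_num at h1
  rw [quadQ, quadF, D_blockMap, ← he]
  set x := ‖h‖ ^ 2
  set y := ‖blockMap (M + 1) A h‖ ^ 2
  set z := ‖A.toEuclideanLin e‖ ^ 2
  set l := lambdaMax A
  have hz : 0 ≤ z := by positivity
  have hx : 0 ≤ x := by positivity
  have hE : 0 ≤ ‖e‖ ^ 2 := by positivity
  set E := ‖e‖ ^ 2
  have hpos : 0 ≤ x - (3 - s) / 4 * E := by
    have h0 : 0 ≤ ‖h - (1 / 2 : ℝ) • Dadj c n e‖ ^ 2 := by positivity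
    rw [norm_sub_sq_real, inner_smul_right, ← inner_Dadj, ← he, real_inner_self_eq_norm_sq,
      norm_smul, mul_pow, norm_sq_Dadj, ← hs'] at h0
    norm_num at h0
    linarith
  have h1' : y - (3 - s) / 4 * z ≤ l * (x - (3 - s) / 4 * E) := by linarith
  have hl : l ≤ 1 / (2 * η) := by
    rw [le_div_iff₀ (by positivity)]; linarith
  have h3 : l * (x - (3 - s) / 4 * E) ≤ 1 / (2 * η) * (x - (3 - s) / 4 * E) := by gcongr
  have h4 : l * E ≤ 1 / (2 * η) * E := by gcongr
  have h5 : (1 - s) / 4 * z ≤ (1 - s) / 4 * (1 / (2 * η) * E) := by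
    have : 0 ≤ (1 - s) / 4 := by linarith
    gcongr
    linarith
  have e4 : 1 / (4 * η) * E = 1 / 2 * (1 / (2 * η) * E) := by field_simp; ring
  rw [e4]
  linarith

variable {A c} in
lemma norm_sub_smul_hessQ_le (hs : ∑ i, c i ^ 2 ≤ 1) {η : ℝ} (hη : 0 < η)
    (hηA : 2 * η * lambdaMax A ≤ 1) (x : Stack (M + 1) n) :
    ‖x - η • hessQ A c η x‖ ≤ ‖x‖ := by
  set y := x - η • hessQ A c η x with hy
  have hle : ∀ h : Stack (M + 1) n, 2 * η * quadQ A c η h ≤ ‖h‖ ^ 2 := fun h => by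
    have := quadQ_le hs hη hηA h
    rw [div_mul_eq_mul_div, le_div_iff₀ (by positivity)] at this
    linarith
  have hnn : ∀ h : Stack (M + 1) n, 0 ≤ 2 * η * quadQ A c η h := fun h => by
    have := quadQ_nonneg (A := A) hs hη h
    positivity
  have hself : ∀ h : Stack (M + 1) n,
      inner ℝ h (η • hessQ A c η h) = 2 * η * quadQ A c η h := fun h => by
    rw [inner_smul_right, real_inner_comm, inner_hessQ_self]; ring
  have e1 : inner ℝ x y = ‖x‖ ^ 2 - 2 * η * quadQ A c η x := by
    rw [hy, inner_sub_right, hself, real_inner_self_eq_norm_sq]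
  have e2 : inner ℝ x (η • hessQ A c η y) = inner ℝ x y - ‖y‖ ^ 2 := by
    rw [inner_smul_right, ← inner_hessQ_comm, ← real_inner_self_eq_norm_sq]
    nth_rewrite 3 [hy]
    rw [inner_sub_left, inner_smul_left]
    simp
  have e3 := quadQ_sub A c η x y
  rw [inner_smul_right] at e2
  have h1 := hle (x - y)
  have h2 := hnn y
  have h3 := hnn x
  have e4 : ‖x - y‖ ^ 2 = ‖x‖ ^ 2 - 2 * inner ℝ x y + ‖y‖ ^ 2 := norm_sub_sq_real x y
  have e5 : 2 * η * quadQ A c η (x - y) = 2 * η * quadQ A c η x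
      - 2 * (η * inner ℝ x (hessQ A c η y)) + 2 * η * quadQ A c η y := by rw [e3]; ring
  rw [e2] at e5
  refine (sq_le_sq₀ (norm_nonneg _) (norm_nonneg _)).1 ?_
  linarith

lemma mul_le_mul_of_sq_le {a a' l x y : ℝ} (hl : 0 ≤ l) (hx : 0 ≤ x) (hy : 0 ≤ y)
    (ha : a ^ 2 ≤ l * x ^ 2) (ha' : a' ^ 2 ≤ l * y ^ 2) : a * a' ≤ l * (x * y) := by
  refine le_of_sq_le_sq ?_ (by positivity)
  calc (a * a') ^ 2 = a ^ 2 * a' ^ 2 := mul_pow _ _ _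
    _ ≤ (l * x ^ 2) * (l * y ^ 2) := by gcongr
    _ = (l * (x * y)) ^ 2 := by ring

variable {A c} in
lemma inner_hessQ_le (hl : 0 ≤ lambdaMax A) (hs : ∑ i, c i ^ 2 ≤ 1) {η : ℝ} (hη : 0 < η)
    (x y : Stack (M + 1) n) :
    inner ℝ (hessQ A c η x) y ≤ (4 * lambdaMax A + 1 / η) * (‖x‖ * ‖y‖) := by
  have hA := norm_sq_blockMap_le (N := M + 1) A
  have h1 : inner ℝ (blockMap (M + 1) A x) (blockMap (M + 1) A y) ≤ lambdaMax A * (‖x‖ * ‖y‖) :=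
    (real_inner_le_norm _ _).trans
      (mul_le_mul_of_sq_le hl (norm_nonneg _) (norm_nonneg _) (hA x) (hA y))
  have hDA : ∀ z : Stack (M + 1) n,
      ‖D c m (blockMap (M + 1) A z)‖ ^ 2 ≤ 2 * lambdaMax A * ‖z‖ ^ 2 := fun z => by
    have := norm_sq_D_le hs m (blockMap (M + 1) A z)
    linarith [hA z]
  have h2 : -inner ℝ (D c m (blockMap (M + 1) A x)) (D c m (blockMap (M + 1) A y))
      ≤ 2 * lambdaMax A * (‖x‖ * ‖y‖) :=
    (neg_le_abs _).trans ((abs_real_inner_le_norm _ _).trans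
      (mul_le_mul_of_sq_le (by positivity) (norm_nonneg _) (norm_nonneg _) (hDA x) (hDA y)))
  have h3 : inner ℝ (D c n x) (D c n y) ≤ 2 * (‖x‖ * ‖y‖) :=
    (real_inner_le_norm _ _).trans
      (mul_le_mul_of_sq_le zero_le_two (norm_nonneg _) (norm_nonneg _) (norm_sq_D_le hs n x)
        (norm_sq_D_le hs n y))
  have h4 : 1 / (2 * η) * inner ℝ (D c n x) (D c n y) ≤ 1 / (2 * η) * (2 * (‖x‖ * ‖y‖)) := by
    gcongr
  have e : 1 / (2 * η) * (2 * (‖x‖ * ‖y‖)) = 1 / η * (‖x‖ * ‖y‖) := by field_simp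
  rw [inner_hessQ]
  linarith

lemma step_eq {η : ℝ} (hη : η ≠ 0) (w : Stack (M + 1) n) :
    step A c b η w = clip (w - η • gradQ A c b η w) := by
  set g := (2 : ℝ) • blockMap (M + 1) A.transpose (blockMap (M + 1) A w - b) with hg
  have hl : localStep A b η w = w - η • g := by
    ext1 i
    simp [localStep, hg]
  have hserver : ∀ v : Stack (M + 1) n,
      serverStep c v = clip (v - (1 / 2 : ℝ) • Dadj c n (D c n v)) := by
    intro v
    rw [serverStep]
    congr 1
    ext1 i
    refine Fin.lastCases ?_ (fun i => ?_) i
    · simp [D_apply]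
      module
    · simp [D_apply]
      module
  rw [step, hl, hserver]
  congr 1
  rw [gradQ, gradF, ← hg, blockMap_Dadj, ← D_blockMap, map_sub, map_smul, Dadj_sub, Dadj_smul, hg,
    map_smul, Dadj_smul]
  have : η * (1 / (2 * η)) = 1 / 2 := by field_simp
  simp only [smul_sub, smul_add, smul_smul, this]
  module

end Quadratic

/-! ### Projection onto the orthant -/

lemma clip_apply {N p : ℕ} (z : Stack N p) (i : Fin N) (j : Fin p) :
    clip z i j = max (z i j) 0 := rfl

lemma clip_nonneg {N p : ℕ} (z : Stack N p) : Nonneg (clip z) := fun _ _ => le_max_right _ _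

lemma inner_sub_clip_nonpos {N p : ℕ} (z : Stack N p) {q : Stack N p} (hq : Nonneg q) :
    inner ℝ (z - clip z) (q - clip z) ≤ 0 := by
  rw [stack_inner_eq]
  refine Finset.sum_nonpos fun i _ => Finset.sum_nonpos fun j _ => ?_
  have h := hq i j
  have e1 : (z - clip z) i j = z i j - max (z i j) 0 := rfl
  have e2 : (q - clip z) i j = q i j - max (z i j) 0 := rfl
  rw [e1, e2]
  rcases le_total 0 (z i j) with h0 | h0
  · simp [max_eq_left h0]
  · rw [max_eq_right h0]
    nlinarith

section Convergence

variable {M m n : ℕ} {A : Matrix (Fin m) (Fin n) ℝ} {c : Fin M → ℝ} {b : Stack (M + 1) m}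

lemma step_nonneg (η : ℝ) (w : Stack (M + 1) n) : Nonneg (step A c b η w) := clip_nonneg _

lemma inner_gradQ_step_le {η : ℝ} (hη : 0 < η) (w : Stack (M + 1) n) {q : Stack (M + 1) n}
    (hq : Nonneg q) :
    η * inner ℝ (gradQ A c b η w) (step A c b η w - q)
      ≤ inner ℝ (w - step A c b η w) (step A c b η w - q) := by
  have h := inner_sub_clip_nonpos (w - η • gradQ A c b η w) hq
  rw [← step_eq A c b hη.ne'] at h
  set x := step A c b η w
  have e : inner ℝ (w - η • gradQ A c b η w - x) (q - x)
      = η * inner ℝ (gradQ A c b η w) (x - q) - inner ℝ (w - x) (x - q) := by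
    rw [← neg_sub x q, inner_neg_right, sub_right_comm, inner_sub_left, inner_smul_left]
    simp
  linarith

lemma Q_ge_linearization (hs : ∑ i, c i ^ 2 ≤ 1) {η : ℝ} (hη : 0 < η) (w q : Stack (M + 1) n) :
    Q A c b η w - Q A c b η q ≤ inner ℝ (gradQ A c b η w) (w - q) := by
  have h := Q_add A c b η w (q - w)
  rw [add_sub_cancel, ← neg_sub w q, inner_neg_right, neg_sub] at h
  have := quadQ_nonneg (A := A) hs hη (q - w)
  linarith

/-- The basic inequality of the projected gradient method. -/
lemma Q_step_le (hs : ∑ i, c i ^ 2 ≤ 1) {η : ℝ} (hη : 0 < η) (hηA : 2 * η * lambdaMax A ≤ 1)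
    (w : Stack (M + 1) n) {q : Stack (M + 1) n} (hq : Nonneg q) :
    Q A c b η (step A c b η w)
      ≤ Q A c b η q + 1 / (2 * η) * (‖w - q‖ ^ 2 - ‖step A c b η w - q‖ ^ 2) := by
  have h1 := inner_gradQ_step_le (A := A) (c := c) (b := b) hη w hq
  set x := step A c b η w
  have h2 := Q_ge_linearization (A := A) (b := b) hs hη w q
  have h3 := Q_add A c b η w (x - w)
  rw [add_sub_cancel] at h3
  have h4 := quadQ_le (A := A) hs hη hηA (x - w)
  have e1 : inner ℝ (gradQ A c b η w) (x - q)
      = inner ℝ (gradQ A c b η w) (x - w) + inner ℝ (gradQ A c b η w) (w - q) := by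
    rw [← inner_add_right, sub_add_sub_cancel]
  have e2 : ‖w - q‖ ^ 2 = ‖x - w‖ ^ 2 + 2 * inner ℝ (w - x) (x - q) + ‖x - q‖ ^ 2 := by
    rw [← sub_add_sub_cancel w x q, norm_add_sq_real, norm_sub_rev w x]
  have h5 : inner ℝ (gradQ A c b η w) (x - q)
      ≤ 1 / (2 * η) * (2 * inner ℝ (w - x) (x - q)) := by
    rw [div_mul_eq_mul_div, le_div_iff₀ (by positivity)]
    linarith
  rw [e2]
  linarith

lemma Q_step_le_self (hs : ∑ i, c i ^ 2 ≤ 1) {η : ℝ} (hη : 0 < η)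
    (hηA : 2 * η * lambdaMax A ≤ 1) {w : Stack (M + 1) n} (hw : Nonneg w) :
    Q A c b η (step A c b η w) ≤ Q A c b η w - 1 / (2 * η) * ‖step A c b η w - w‖ ^ 2 := by
  have := Q_step_le (A := A) (b := b) hs hη hηA w hw
  simp only [sub_self, norm_zero] at this
  linarith

lemma F_ge_of_isOptimalPair (hs : ∑ i, c i ^ 2 ≤ 1) {u : Stack (M + 1) n}
    {μ : EuclideanSpace ℝ (Fin n)} (hu : IsOptimalPair A c b u μ) {w : Stack (M + 1) n}
    (hw : Nonneg w) :
    F A c b u - inner ℝ (D c n w) μ + quadF A c (w - u) ≤ F A c b w := by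
  obtain ⟨-, hDu, hcone⟩ := hu
  have h := hcone w hw
  rw [gradient_F b hs, adjoint_D, inner_neg_left, inner_add_left,
    real_inner_comm (w - u) (Dadj c n μ), ← inner_Dadj, map_sub, hDu, sub_zero] at h
  have h2 := F_add A c b u (w - u)
  rw [add_sub_cancel] at h2
  linarith

/-- Quadratic growth of the penalty function around the solution set, up to an error `4 η³`. -/
lemma Q_growth (hl : 0 ≤ lambdaMax A) (hs : ∑ i, c i ^ 2 ≤ 1) {u : Stack (M + 1) n}
    {μ : EuclideanSpace ℝ (Fin n)} (hu : IsOptimalPair A c b u μ) {H η : ℝ} (hη : 0 < η)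
    (hηH : η ≤ H) (hμ : ‖μ‖ ≤ η) {w : Stack (M + 1) n} (hw : Nonneg w) :
    1 / (1 + 4 * lambdaMax A * H) * ‖blockMap (M + 1) A (w - u)‖ ^ 2
      + 1 / (16 * η) * ‖D c n w‖ ^ 2 ≤ Q A c b η w - F A c b u + 4 * η ^ 3 := by
  have hH : 0 < H := hη.trans_le hηH
  have h1 := F_ge_of_isOptimalPair (b := b) hs hu hw
  have hq := quadF_nonneg (A := A) hs (w - u)
  have h2 : inner ℝ (D c n w) μ ≤ ‖D c n w‖ * η :=
    (real_inner_le_norm _ _).trans (by gcongr)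
  have h3 : ‖D c m (blockMap (M + 1) A (w - u))‖ ^ 2 ≤ lambdaMax A * ‖D c n w‖ ^ 2 := by
    rw [D_blockMap, map_sub, hu.2.1, sub_zero]
    exact norm_sq_toEuclideanLin_le A _
  rw [Q]
  set x := ‖D c n w‖
  set l := lambdaMax A
  set θ := 1 / (1 + 4 * l * H) with hθ
  have hθ0 : 0 < θ := by positivity
  have hθ1 : θ ≤ 1 := by
    rw [hθ, div_le_one (by positivity)]
    have : 0 ≤ 4 * l * H := by positivity
    linarith
  have h4 : θ * quadF A c (w - u) ≤ quadF A c (w - u) := by nlinarith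
  have h5 : θ * (‖blockMap (M + 1) A (w - u)‖ ^ 2 - 1 / 2 * (l * x ^ 2))
      ≤ θ * quadF A c (w - u) := by
    rw [quadF]
    gcongr
  have h6 : θ * (1 / 2 * (l * x ^ 2)) ≤ 1 / (8 * η) * x ^ 2 := by
    have : θ * (1 / 2 * l) ≤ 1 / (8 * η) := by
      rw [le_div_iff₀ (by positivity), hθ, div_mul_eq_mul_div, div_mul_eq_mul_div,
        div_le_one (by positivity)]
      nlinarith
    nlinarith [sq_nonneg x]
  have h7 : x * η ≤ 1 / (16 * η) * x ^ 2 + 4 * η ^ 3 := by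
    have : 0 ≤ (x - 8 * η ^ 2) ^ 2 / (16 * η) := by positivity
    have e : (x - 8 * η ^ 2) ^ 2 / (16 * η) = 1 / (16 * η) * x ^ 2 + 4 * η ^ 3 - x * η := by
      field_simp
      ring
    linarith
  have e1 : 1 / (8 * η) * x ^ 2 = 2 * (1 / (16 * η) * x ^ 2) := by field_simp; ring
  have e2 : 1 / (4 * η) * x ^ 2 = 4 * (1 / (16 * η) * x ^ 2) := by field_simp; ring
  rw [e2]
  rw [e1] at h6
  linarith

lemma Q_lower (hl : 0 ≤ lambdaMax A) (hs : ∑ i, c i ^ 2 ≤ 1) {u : Stack (M + 1) n}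
    {μ : EuclideanSpace ℝ (Fin n)} (hu : IsOptimalPair A c b u μ) {η : ℝ} (hη : 0 < η)
    (hμ : ‖μ‖ ≤ η) {w : Stack (M + 1) n} (hw : Nonneg w) :
    F A c b u - 4 * η ^ 3 ≤ Q A c b η w := by
  have h := Q_growth (b := b) hl hs hu hη le_rfl hμ hw
  have : 0 ≤ 1 / (1 + 4 * lambdaMax A * η) * ‖blockMap (M + 1) A (w - u)‖ ^ 2
      + 1 / (16 * η) * ‖D c n w‖ ^ 2 := by positivity
  linarith

lemma F_congr {w w' : Stack (M + 1) n} (h : blockMap (M + 1) A w = blockMap (M + 1) A w') :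
    F A c b w = F A c b w' := by
  rw [F_eq, F_eq, h]

lemma le_of_sq_le_linear {d P S η : ℝ} (hP : 0 ≤ P) (hS : 0 ≤ S) (hη : 0 < η)
    (h : d ^ 2 ≤ P * (η * d) + S * η ^ 2) : d ≤ (P + S + 1) * η := by
  by_contra hlt
  push Not at hlt
  have h1 : η ≤ d := by nlinarith
  have h2 : 0 < d := hη.trans_le h1
  have h3 : (P + S + 1) * η * d < d * d := by gcongr
  have h4 : S * (η * η) ≤ S * (η * d) := by gcongr
  nlinarith [mul_pos hη h2]

/-- A terminating inner loop returns a point of value within `O(η²)` of the optimal one. -/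
lemma exists_terminal_bound (hl : 0 ≤ lambdaMax A) (hs : ∑ i, c i ^ 2 ≤ 1) {H : ℝ} (hH : 0 < H) :
    ∃ B : ℝ, 0 < B ∧ ∀ (b : Stack (M + 1) m) (u : Stack (M + 1) n)
      (μ : EuclideanSpace ℝ (Fin n)), IsOptimalPair A c b u μ → ∀ η : ℝ, 0 < η → η ≤ H → ‖μ‖ ≤ η →
      ∀ w : Stack (M + 1) n, ‖step A c b η w - w‖ ≤ η ^ 2 →
      Q A c b η (step A c b η w) - F A c b u ≤ B * η ^ 2 := by
  obtain ⟨κ, hκ, hhof⟩ := hoffman_orthant ((D c n).prod (blockMap (M + 1) A))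
  set θ := 1 / (1 + 4 * lambdaMax A * H) with hθ
  have hθ0 : 0 < θ := by positivity
  set ρ := min θ (1 / (16 * H)) with hρ
  have hρ0 : 0 < ρ := lt_min hθ0 (by positivity)
  set C₁ := 4 * lambdaMax A * H + 2 with hC₁
  have hC₁0 : 0 < C₁ := by positivity
  refine ⟨C₁ * (κ ^ 2 / ρ * C₁ + κ ^ 2 / ρ * (4 * H) + 1), by positivity, ?_⟩
  intro b u μ hu η hη hηH hμ w hw
  set x := step A c b η w with hx
  have hxn : Nonneg x := step_nonneg η w
  obtain ⟨q, hqn, hBq, hqd⟩ := hhof x u hxn hu.1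
  have hDq : D c n q = 0 := by
    have := congrArg Prod.fst hBq
    simpa [hu.2.1] using this
  have hAq : blockMap (M + 1) A q = blockMap (M + 1) A u := congrArg Prod.snd hBq
  have hQq : Q A c b η q = F A c b u := by
    rw [Q, hDq, F_congr hAq]
    simp
  set d := ‖x - q‖ with hd
  have hd0 : 0 ≤ d := norm_nonneg _
  have hup : Q A c b η x - F A c b u ≤ C₁ * (η * d) := by
    have h1 := Q_ge_linearization (A := A) (b := b) hs hη x q
    have h2 := gradQ_add A c b η w (x - w)
    rw [add_sub_cancel] at h2
    rw [h2, inner_add_left, hQq] at h1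
    have h3 := inner_gradQ_step_le (A := A) (c := c) (b := b) hη w hqn
    rw [← hx] at h3
    have h4 : inner ℝ (w - x) (x - q) ≤ η ^ 2 * d :=
      (real_inner_le_norm _ _).trans (by rw [norm_sub_rev]; gcongr)
    have h5 := inner_hessQ_le (A := A) hl hs hη (x - w) (x - q)
    have h6 : (4 * lambdaMax A + 1 / η) * (‖x - w‖ * ‖x - q‖)
        ≤ (4 * lambdaMax A + 1 / η) * (η ^ 2 * d) := by gcongr
    have h7 : (4 * lambdaMax A + 1 / η) * (η ^ 2 * d) = (4 * lambdaMax A * η + 1) * (η * d) := by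
      field_simp
    have h8 : (4 * lambdaMax A * η + 1) * (η * d) ≤ (4 * lambdaMax A * H + 1) * (η * d) := by
      gcongr
    have h9 : inner ℝ (gradQ A c b η w) (x - q) ≤ η * d := by
      refine le_of_mul_le_mul_left ?_ hη
      nlinarith
    rw [hC₁]
    linarith
  have hlow := Q_growth (b := b) hl hs hu hη hηH hμ hxn
  rw [← hθ] at hlow
  have hd2 : ρ * d ^ 2 ≤ κ ^ 2 * (C₁ * (η * d) + 4 * H * η ^ 2) := by
    have h1 : d ^ 2 ≤ κ ^ 2 * ‖((D c n).prod (blockMap (M + 1) A)) (x - u)‖ ^ 2 := by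
      rw [← mul_pow]; gcongr
    have h2 : ‖((D c n).prod (blockMap (M + 1) A)) (x - u)‖ ^ 2
        ≤ ‖D c n x‖ ^ 2 + ‖blockMap (M + 1) A (x - u)‖ ^ 2 := by
      have e : D c n (x - u) = D c n x := by rw [map_sub, hu.2.1, sub_zero]
      rw [ContinuousLinearMap.prod_apply, e, Prod.norm_mk]
      rcases max_choice ‖D c n x‖ ‖blockMap (M + 1) A (x - u)‖ with h | h <;> rw [h]
      · have := sq_nonneg ‖blockMap (M + 1) A (x - u)‖; linarith
      · have := sq_nonneg ‖D c n x‖; linarith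
    have h3 : ρ * (‖D c n x‖ ^ 2 + ‖blockMap (M + 1) A (x - u)‖ ^ 2)
        ≤ θ * ‖blockMap (M + 1) A (x - u)‖ ^ 2 + 1 / (16 * η) * ‖D c n x‖ ^ 2 := by
      have h4 : ρ ≤ θ := min_le_left _ _
      have h5 : ρ ≤ 1 / (16 * η) := (min_le_right _ _).trans (by gcongr)
      rw [mul_add, add_comm]
      gcongr
    have h6 : η ^ 3 ≤ H * η ^ 2 := by
      rw [pow_succ, mul_comm]; gcongr
    calc ρ * d ^ 2 ≤ ρ * (κ ^ 2 * (‖D c n x‖ ^ 2 + ‖blockMap (M + 1) A (x - u)‖ ^ 2)) := by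
          gcongr; exact h1.trans (by gcongr)
      _ = κ ^ 2 * (ρ * (‖D c n x‖ ^ 2 + ‖blockMap (M + 1) A (x - u)‖ ^ 2)) := by ring
      _ ≤ κ ^ 2 * (C₁ * (η * d) + 4 * H * η ^ 2) := by
          gcongr
          linarith
  have hdle : d ≤ (κ ^ 2 / ρ * C₁ + κ ^ 2 / ρ * (4 * H) + 1) * η := by
    refine le_of_sq_le_linear (by positivity) (by positivity) hη ?_
    have : d ^ 2 ≤ κ ^ 2 * (C₁ * (η * d) + 4 * H * η ^ 2) / ρ := by
      rw [le_div_iff₀ hρ0]; linarith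
    refine this.trans_eq ?_
    field_simp
  calc Q A c b η x - F A c b u ≤ C₁ * (η * d) := hup
    _ ≤ C₁ * (η * ((κ ^ 2 / ρ * C₁ + κ ^ 2 / ρ * (4 * H) + 1) * η)) := by gcongr
    _ = C₁ * (κ ^ 2 / ρ * C₁ + κ ^ 2 / ρ * (4 * H) + 1) * η ^ 2 := by ring

/-- Lowering the penalty parameter by the factor `r` preserves an `O(η²)` optimality gap. -/
lemma Q_warm_start (hl : 0 ≤ lambdaMax A) (hs : ∑ i, c i ^ 2 ≤ 1) {u : Stack (M + 1) n}
    {μ : EuclideanSpace ℝ (Fin n)} (hu : IsOptimalPair A c b u μ) {B H η r : ℝ} (hη : 0 < η)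
    (hηH : η ≤ H) (hμ : ‖μ‖ ≤ η) (hr : 0 < r) {w : Stack (M + 1) n} (hw : Nonneg w)
    (hB : Q A c b η w - F A c b u ≤ B * η ^ 2) :
    Q A c b (r * η) w - F A c b u ≤ (B + 4 / r * (B + 4 * H)) * η ^ 2 := by
  have hH : 0 < H := hη.trans_le hηH
  have h := Q_growth (b := b) hl hs hu hη hηH hμ hw
  have h0 : 0 ≤ 1 / (1 + 4 * lambdaMax A * H) * ‖blockMap (M + 1) A (w - u)‖ ^ 2 := by positivity
  have h6 : η ^ 3 ≤ H * η ^ 2 := by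
    rw [pow_succ, mul_comm]; gcongr
  have h1 : 1 / (16 * η) * ‖D c n w‖ ^ 2 ≤ (B + 4 * H) * η ^ 2 := by linarith
  have h2 : 0 ≤ 1 / (4 * η) * ‖D c n w‖ ^ 2 := by positivity
  rw [Q] at hB ⊢
  have e : 1 / (4 * (r * η)) * ‖D c n w‖ ^ 2 = 4 / r * (1 / (16 * η) * ‖D c n w‖ ^ 2) := by
    field_simp; ring
  have h3 : 4 / r * (1 / (16 * η) * ‖D c n w‖ ^ 2) ≤ 4 / r * ((B + 4 * H) * η ^ 2) := by gcongr
  rw [e]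
  linarith

/-- The inner loop stops after `O(1/η)` updates if its first update has an `O(η²)` optimality
gap. -/
lemma exists_innerLoop (hl : 0 ≤ lambdaMax A) (hs : ∑ i, c i ^ 2 ≤ 1) {u : Stack (M + 1) n}
    {μ : EuclideanSpace ℝ (Fin n)} (hu : IsOptimalPair A c b u μ) {B H η : ℝ} (hB0 : 0 ≤ B)
    (hη : 0 < η) (hηH : η ≤ H) (hηA : 2 * η * lambdaMax A ≤ 1) (hμ : ‖μ‖ ≤ η)
    (w : Stack (M + 1) n) (hB : Q A c b η (step A c b η w) - F A c b u ≤ B * η ^ 2) :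
    ∃ (w' : Stack (M + 1) n) (T : ℕ), InnerLoop A c b η w w' T ∧
      (T : ℝ) ≤ (2 * B + 10 * H) / η := by
  have hnn : ∀ s, Nonneg ((step A c b η)^[s + 1] w) := fun s => by
    rw [Function.iterate_succ_apply']
    exact step_nonneg _ _
  have hdesc : ∀ k : ℕ, (∀ s < k + 1,
      η ^ 2 < ‖(step A c b η)^[s + 1] w - (step A c b η)^[s] w‖) →
      Q A c b η ((step A c b η)^[k + 1] w) ≤ Q A c b η (step A c b η w) - k * (η ^ 3 / 2) := by
    intro k
    induction k with
    | zero => intro _; simp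
    | succ k ih =>
      intro hk
      have h1 := ih fun s hs => hk s (by omega)
      have h2 := Q_step_le_self (A := A) (b := b) hs hη hηA (hnn k)
      have h3 := hk (k + 1) (by omega)
      rw [Function.iterate_succ_apply' (step A c b η) (k + 1)] at h3 ⊢
      have h4 : 1 / (2 * η) * (η ^ 2) ^ 2
          ≤ 1 / (2 * η) * ‖step A c b η ((step A c b η)^[k + 1] w) - (step A c b η)^[k + 1] w‖ ^ 2 := by
        gcongr
      have e : 1 / (2 * η) * (η ^ 2) ^ 2 = η ^ 3 / 2 := by field_simp
      push_cast
      linarith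
  have hcount : ∀ k : ℕ, (∀ s < k + 1,
      η ^ 2 < ‖(step A c b η)^[s + 1] w - (step A c b η)^[s] w‖) → (k : ℝ) ≤ 2 * B / η + 8 := by
    intro k hk
    have h1 := hdesc k hk
    have h2 := Q_lower (b := b) hl hs hu hη hμ (hnn k)
    have h3 : (k : ℝ) * (η ^ 3 / 2) ≤ (2 * B / η + 8) * (η ^ 3 / 2) := by
      have e : (2 * B / η + 8) * (η ^ 3 / 2) = B * η ^ 2 + 4 * η ^ 3 := by field_simp; ring
      rw [e]
      linarith
    exact le_of_mul_le_mul_right h3 (by positivity)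
  have hex : ∃ t : ℕ, ‖(step A c b η)^[t + 1] w - (step A c b η)^[t] w‖ ≤ η ^ 2 := by
    by_contra hno
    push Not at hno
    obtain ⟨k, hk⟩ := exists_nat_gt (2 * B / η + 8)
    exact absurd (hcount k fun s _ => hno s) (not_le.2 hk)
  classical
  have hmin : ∀ s < Nat.find hex,
      η ^ 2 < ‖(step A c b η)^[s + 1] w - (step A c b η)^[s] w‖ := fun s hs =>
    not_le.1 (Nat.find_min hex hs)
  refine ⟨_, _, ⟨Nat.find hex, rfl, rfl, Nat.find_spec hex, hmin⟩, ?_⟩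
  have h10 : (10 : ℝ) ≤ 10 * H / η := by
    rw [le_div_iff₀ hη]; linarith
  have hBη : 0 ≤ 2 * B / η := by positivity
  rw [add_div]
  rcases Nat.eq_zero_or_pos (Nat.find hex) with h0 | h0
  · rw [h0]
    push_cast
    linarith
  · obtain ⟨k, hk⟩ := Nat.exists_eq_succ_of_ne_zero h0.ne'
    rw [hk] at hmin ⊢
    have := hcount k hmin
    push_cast
    linarith

lemma step_isEtaOptimal (hs : ∑ i, c i ^ 2 ≤ 1) {η : ℝ} (hη : 0 < η)
    (hηA : 2 * η * lambdaMax A ≤ 1) {w : Stack (M + 1) n}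
    (hw : ‖step A c b η w - w‖ ≤ η ^ 2) : IsEtaOptimal A c b η (step A c b η w) := by
  set x := step A c b η w with hx
  set y := (x - w) - η • hessQ A c η (x - w) with hy
  have hyn : ‖y‖ ≤ η ^ 2 := (norm_sub_smul_hessQ_le hs hη hηA (x - w)).trans hw
  have hgrad : η • gradQ A c b η x = -y + (x - (w - η • gradQ A c b η w)) := by
    have h2 := gradQ_add A c b η w (x - w)
    rw [add_sub_cancel] at h2
    rw [h2, hy, smul_add]
    abel
  have hcoord : ∀ i j, η * gradQ A c b η x i j
      = -y i j + (x i j - (w - η • gradQ A c b η w) i j) := fun i j => by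
    have := congrArg (fun z : Stack (M + 1) n => z i j) hgrad
    simpa using this
  have hxc : ∀ i j, x i j = max ((w - η • gradQ A c b η w) i j) 0 := fun i j => by
    rw [hx, step_eq A c b hη.ne', clip_apply]
  refine ⟨step_nonneg η w, ?_, fun i j => ?_⟩
  · rw [gradient_Q b hs hη]
    refine Real.sqrt_le_iff.2 ⟨hη.le, ?_⟩
    have h1 : η ^ 2 * ∑ i, ∑ j, (if η ^ 2 < x i j then (gradQ A c b η x i j) ^ 2 else 0)
        ≤ ‖y‖ ^ 2 := by
      rw [stack_norm_sq_eq, Finset.mul_sum]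
      refine Finset.sum_le_sum fun i _ => ?_
      rw [Finset.mul_sum]
      refine Finset.sum_le_sum fun j _ => ?_
      split_ifs with hij
      · have hpos : 0 < x i j := lt_of_le_of_lt (by positivity) hij
        have h2 : x i j = (w - η • gradQ A c b η w) i j := by
          rcases max_choice ((w - η • gradQ A c b η w) i j) 0 with h | h
          · rw [hxc, h]
          · rw [hxc, h] at hpos
            exact absurd hpos (lt_irrefl _)
        have h3 := hcoord i j
        rw [← h2, sub_self, add_zero] at h3
        rw [← mul_pow, h3, neg_sq]
      · rw [mul_zero]; positivity
    have h2 : ‖y‖ ^ 2 ≤ (η ^ 2) ^ 2 := by gcongr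
    have h3 : (η ^ 2) ^ 2 = η ^ 2 * η ^ 2 := by ring
    exact le_of_mul_le_mul_left (h1.trans (h2.trans_eq h3)) (by positivity)
  · rw [gradient_Q b hs hη]
    have h1 := hcoord i j
    have h2 : (w - η • gradQ A c b η w) i j ≤ x i j := by rw [hxc]; exact le_max_left _ _
    have h3 : y i j ≤ η ^ 2 := (le_abs_self _).trans ((abs_coord_le_norm y i j).trans hyn)
    refine le_of_mul_le_mul_left ?_ hη
    linarith [sq η]

end Convergence

section OuterLoop

variable {M m n : ℕ} {A : Matrix (Fin m) (Fin n) ℝ} {c : Fin M → ℝ} {b : Stack (M + 1) m}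

lemma stepBound_pos (hA : A ≠ 0) (hs : ∑ i, c i ^ 2 ≤ 1) : 0 < stepBound A c := by
  have := lambdaMax_pos A hA
  exact div_pos (by linarith) (by positivity)

lemma two_mul_lambdaMax_le_one (hA : A ≠ 0) {η : ℝ} (h : η ≤ stepBound A c) :
    2 * η * lambdaMax A ≤ 1 := by
  have hl := lambdaMax_pos A hA
  rw [stepBound, le_div_iff₀ (by positivity)] at h
  have : 0 ≤ ∑ i, c i ^ 2 := Finset.sum_nonneg fun i _ => sq_nonneg _
  linarith

lemma eta_succ (β r : ℝ) (k : ℕ) : eta A c β r (k + 1) = r * eta A c β r k := by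
  rw [eta, eta, pow_succ]; ring

lemma InnerLoop.exists_eq_step {η : ℝ} {w w' : Stack (M + 1) n} {T : ℕ}
    (h : InnerLoop A c b η w w' T) :
    ∃ x : Stack (M + 1) n, w' = step A c b η x ∧ ‖step A c b η x - x‖ ≤ η ^ 2 := by
  obtain ⟨t, -, rfl, ht, -⟩ := h
  rw [Function.iterate_succ_apply'] at ht ⊢
  exact ⟨_, rfl, ht⟩

lemma Run.extend {β r : ℝ} {u0 : Stack (M + 1) n} {K : ℕ} {u : ℕ → Stack (M + 1) n} {T : ℕ → ℕ}
    (h : Run A c b β r u0 K u T) {w : Stack (M + 1) n} {t : ℕ}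
    (hw : InnerLoop A c b (eta A c β r K) (u K) w t) :
    Run A c b β r u0 (K + 1) (Function.update u (K + 1) w) (Function.update T K t) := by
  refine ⟨by rw [Function.update_of_ne (by omega)]; exact h.1, fun k hk => ?_⟩
  rw [Function.update_of_ne (by omega : k ≠ K + 1)]
  rcases Nat.lt_succ_iff_lt_or_eq.1 hk with hk | rfl
  · rw [Function.update_of_ne (by omega), Function.update_of_ne (by omega)]
    exact h.2 k hk
  · rw [Function.update_self, Function.update_self]
    exact hw

lemma sum_range_update (T : ℕ → ℕ) (K t : ℕ) :
    ∑ k ∈ Finset.range (K + 1), Function.update T K t k = ∑ k ∈ Finset.range K, T k + t := by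
  rw [Finset.sum_range_succ, Function.update_self]
  congr 1
  exact Finset.sum_congr rfl fun k hk => Function.update_of_ne (Finset.mem_range.1 hk).ne _ _

end OuterLoop

end FIRM

end

theorem mainTheorem2 {M m n : ℕ} (A : Matrix (Fin m) (Fin n) ℝ) (hA : A ≠ 0)
    (c : Fin M → ℝ) (hc : ∀ i, 0 ≤ c i) (hc_pos : 0 < ∑ i, c i) (hc_le : ∑ i, c i ≤ 1)
    (β r R : ℝ) (hβ : 1 ≤ β) (hr0 : 0 < r) (hr1 : r < 1) :
    ∃ C : ℝ, 0 < C ∧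
      ∀ (b : FIRM.Stack (M + 1) m) (u0 ustar : FIRM.Stack (M + 1) n)
        (mustar : EuclideanSpace ℝ (Fin n)),
        FIRM.IsOptimalPair A c b ustar mustar → ‖u0 - ustar‖ ≤ R →
        ∀ (K : ℕ) (u : ℕ → FIRM.Stack (M + 1) n) (T : ℕ → ℕ),
          FIRM.Run A c b β r u0 K u T →
          FIRM.eta A c β r K ≤ FIRM.stepBound A c →
          -- the inner loop of outer iteration `K + 1`
          (FIRM.threshold A c b ustar mustar ≤ FIRM.eta A c β r K →
            ∃ (w : FIRM.Stack (M + 1) n) (t : ℕ),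
              FIRM.InnerLoop A c b (FIRM.eta A c β r K) (u K) w t ∧
              (t : ℝ) ≤ C / FIRM.eta A c β r K) ∧
          -- the whole algorithm with termination tolerance `ε`
          (∀ ε : ℝ, 0 < ε → FIRM.threshold A c b ustar mustar ≤ ε → ε ≤ FIRM.eta A c β r K →
            ∃ (L : ℕ) (u' : ℕ → FIRM.Stack (M + 1) n) (T' : ℕ → ℕ),
              K ≤ L ∧ ε ≤ FIRM.eta A c β r L ∧ FIRM.eta A c β r (L + 1) < ε ∧
              FIRM.Run A c b β r u0 (L + 1) u' T' ∧
              ((∑ k ∈ Finset.range (L + 1), T' k : ℕ) : ℝ)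
                ≤ ((∑ k ∈ Finset.range K, T k : ℕ) : ℝ) + C / ε ∧
              FIRM.IsEtaOptimal A c b (FIRM.eta A c β r L) (u' (L + 1)) ∧
              |FIRM.Q A c b (FIRM.eta A c β r L) (u' (L + 1)) - FIRM.F A c b ustar| ≤ C * ε) := by
  have hs := FIRM.sum_sq_le_one hc hc_le
  have hl := (FIRM.lambdaMax_pos A hA).le
  have hbar : 0 < FIRM.stepBound A c := FIRM.stepBound_pos hA hs
  set ηbar := FIRM.stepBound A c with hηbar
  set H := β * ηbar with hH
  have hH0 : 0 < H := by positivity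
  have hbarH : ηbar ≤ H := le_mul_of_one_le_left hbar.le hβ
  set e : ℕ → ℝ := FIRM.eta A c β r with he
  have he_eq : ∀ k, e k = r ^ k * H := fun k => rfl
  have he0 : ∀ k, 0 < e k := fun k => by rw [he_eq]; positivity
  have hesucc : ∀ k, e (k + 1) = r * e k := FIRM.eta_succ β r
  have hanti : Antitone e := antitone_nat_of_succ_le fun k => by
    rw [hesucc]; nlinarith [he0 k]
  have heH : ∀ k, e k ≤ H := fun k => by
    have := hanti (Nat.zero_le k)
    rwa [he_eq 0, pow_zero, one_mul] at this
  obtain ⟨B, hB0, hB⟩ := FIRM.exists_terminal_bound (A := A) (c := c) hl hs hH0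
  set W := (B + 4 / r * (B + 4 * H)) / r ^ 2 + R ^ 2 / (2 * ηbar ^ 3) with hW
  have hW0 : 0 < W := by positivity
  set C₀ := 2 * W + 10 * H with hC₀
  have hC₀0 : 0 < C₀ := by positivity
  have hr' : 0 < 1 - r := by linarith
  refine ⟨C₀ / (1 - r) + (B * H + 4 * H ^ 2) / r, by positivity, ?_⟩
  intro b u0 ustar mustar hopt hR K u T hrun hK
  have inner_loop : ∀ (k : ℕ) (u : ℕ → FIRM.Stack (M + 1) n) (T : ℕ → ℕ),
      FIRM.Run A c b β r u0 k u T → e k ≤ ηbar → ‖mustar‖ ≤ e k →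
      ∃ (w : FIRM.Stack (M + 1) n) (t : ℕ), FIRM.InnerLoop A c b (e k) (u k) w t ∧
        (t : ℝ) ≤ C₀ / e k := by
    intro k u T hrun hk hμ
    have hkA := FIRM.two_mul_lambdaMax_le_one hA hk
    refine FIRM.exists_innerLoop hl hs hopt hW0.le (he0 k) (heH k) hkA hμ (u k) ?_
    cases k with
    | zero =>
      rw [hrun.1]
      have h1 := FIRM.Q_step_le (b := b) hs (he0 0) hkA u0 hopt.1
      have h2 : FIRM.Q A c b (e 0) ustar = FIRM.F A c b ustar := by
        rw [FIRM.Q, hopt.2.1]; simp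
      have h3 : ‖u0 - ustar‖ ^ 2 ≤ R ^ 2 := by gcongr
      have h4 : ηbar ≤ e 0 := by rw [he_eq, pow_zero, one_mul]; exact hbarH
      have h5 : 1 / (2 * e 0) * (‖u0 - ustar‖ ^ 2 - ‖FIRM.step A c b (e 0) u0 - ustar‖ ^ 2)
          ≤ 1 / (2 * e 0) * R ^ 2 := by
        have := he0 0
        gcongr
        have := sq_nonneg ‖FIRM.step A c b (e 0) u0 - ustar‖
        linarith
      have h6 : 1 / (2 * e 0) * R ^ 2 = R ^ 2 / (2 * e 0 ^ 3) * e 0 ^ 2 := by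
        have := (he0 0).ne'
        field_simp
      have h7 : R ^ 2 / (2 * e 0 ^ 3) * e 0 ^ 2 ≤ R ^ 2 / (2 * ηbar ^ 3) * e 0 ^ 2 := by gcongr
      have h8 : 0 ≤ (B + 4 / r * (B + 4 * H)) / r ^ 2 * e 0 ^ 2 := by positivity
      rw [hW, add_mul]
      linarith
    | succ k =>
      obtain ⟨x, hx, hxle⟩ := (hrun.2 k (Nat.lt_succ_self k)).exists_eq_step
      have hμk : ‖mustar‖ ≤ e k := hμ.trans (hanti (Nat.le_succ k))
      have hnn : FIRM.Nonneg (u (k + 1)) := by rw [hx]; exact FIRM.step_nonneg _ _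
      have h1 := hB b ustar mustar hopt (e k) (he0 k) (heH k) hμk x hxle
      have hx' : u (k + 1) = FIRM.step A c b (e k) x := hx
      rw [← hx'] at h1
      have h2 := FIRM.Q_warm_start hl hs hopt (he0 k) (heH k) hμk hr0 hnn h1
      rw [← hesucc] at h2
      have h3 := FIRM.Q_step_le_self (b := b) hs (he0 (k + 1)) hkA hnn
      have h4 : 0 ≤ 1 / (2 * e (k + 1))
          * ‖FIRM.step A c b (e (k + 1)) (u (k + 1)) - u (k + 1)‖ ^ 2 := by
        have := he0 (k + 1)
        positivity
      have h5 : (B + 4 / r * (B + 4 * H)) * e k ^ 2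
          = (B + 4 / r * (B + 4 * H)) / r ^ 2 * e (k + 1) ^ 2 := by
        rw [hesucc]
        field_simp
      have h6 : 0 ≤ R ^ 2 / (2 * ηbar ^ 3) * e (k + 1) ^ 2 := by positivity
      rw [hW, add_mul]
      linarith
  have hC₀le : C₀ ≤ C₀ / (1 - r) := by
    rw [le_div_iff₀ hr']; nlinarith
  have hrest : 0 ≤ (B * H + 4 * H ^ 2) / r := by positivity
  refine ⟨fun hτ => ?_, fun ε hε hτ hεK => ?_⟩
  · obtain ⟨w, t, hw, ht⟩ := inner_loop K u T hrun hK ((le_max_left _ _).trans hτ)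
    refine ⟨w, t, hw, ht.trans ?_⟩
    have := he0 K
    gcongr
    linarith
  · have hμε : ‖mustar‖ ≤ ε := (le_max_left _ _).trans hτ
    have hrounds : ∀ j : ℕ, (∀ i < j, ε ≤ e (K + i)) →
        ∃ (u' : ℕ → FIRM.Stack (M + 1) n) (T' : ℕ → ℕ), FIRM.Run A c b β r u0 (K + j) u' T' ∧
          ((∑ k ∈ Finset.range (K + j), T' k : ℕ) : ℝ)
            ≤ ((∑ k ∈ Finset.range K, T k : ℕ) : ℝ) + C₀ / (1 - r) * (r / e (K + j)) := by
      intro j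
      induction j with
      | zero =>
        intro _
        refine ⟨u, T, hrun, ?_⟩
        have := he0 (K + 0)
        have : 0 ≤ C₀ / (1 - r) * (r / e (K + 0)) := by positivity
        simpa using this
      | succ j ih =>
        intro hj
        obtain ⟨u', T', hrun', hsum⟩ := ih fun i hi => hj i (by omega)
        obtain ⟨w, t, hw, ht⟩ := inner_loop (K + j) u' T' hrun'
          ((hanti (Nat.le_add_right K j)).trans hK) (hμε.trans (hj j (Nat.lt_succ_self j)))
        refine ⟨_, _, hrun'.extend hw, ?_⟩
        rw [← add_assoc, FIRM.sum_range_update, Nat.cast_add]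
        have h1 : C₀ / (1 - r) * (r / e (K + j + 1))
            = C₀ / (1 - r) * (r / e (K + j)) + C₀ / e (K + j) := by
          have := (he0 (K + j)).ne'
          have := hr'.ne'
          rw [hesucc]
          field_simp
          ring
        rw [h1]
        linarith
    have hex : ∃ k, e k < ε := by
      obtain ⟨k, hk⟩ := exists_pow_lt_of_lt_one (div_pos hε hH0) hr1
      exact ⟨k, by rw [he_eq]; exact (lt_div_iff₀ hH0).1 hk⟩
    classical
    have hfind : K < Nat.find hex := by
      by_contra hle
      exact absurd (hεK.trans (hanti (not_lt.1 hle))) (not_le.2 (Nat.find_spec hex))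
    obtain ⟨j, hj⟩ := Nat.exists_eq_add_of_lt hfind
    have hlast : e (K + j + 1) < ε := by rw [← hj]; exact Nat.find_spec hex
    have hbefore : ∀ i < j + 1, ε ≤ e (K + i) := fun i hi =>
      not_lt.1 (Nat.find_min hex (by omega))
    have hL : ε ≤ e (K + j) := hbefore j (Nat.lt_succ_self j)
    obtain ⟨u', T', hrun', hsum⟩ := hrounds (j + 1) hbefore
    obtain ⟨x, hx, hxle⟩ := (hrun'.2 (K + j) (by omega)).exists_eq_step
    have hx' : u' (K + j + 1) = FIRM.step A c b (e (K + j)) x := hx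
    have hμL : ‖mustar‖ ≤ e (K + j) := hμε.trans hL
    have hLbar : e (K + j) ≤ ηbar := (hanti (Nat.le_add_right K j)).trans hK
    have hLA := FIRM.two_mul_lambdaMax_le_one hA hLbar
    refine ⟨K + j, u', T', Nat.le_add_right K j, hL, hlast, hrun', ?_, ?_, ?_⟩
    · refine hsum.trans ?_
      have h1 : r / e (K + (j + 1)) = 1 / e (K + j) := by
        have := (he0 (K + j)).ne'
        rw [← add_assoc, hesucc]
        field_simp
      have h2 : 1 / e (K + j) ≤ 1 / ε := by gcongr
      have h3 : C₀ / (1 - r) * (1 / e (K + j)) ≤ C₀ / (1 - r) * (1 / ε) := by gcongr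
      have h4 : 0 ≤ (B * H + 4 * H ^ 2) / r * (1 / ε) := by positivity
      rw [h1, div_eq_mul_one_div (C₀ / (1 - r) + _) ε, add_mul]
      linarith
    · rw [hx]
      exact FIRM.step_isEtaOptimal hs (he0 _) hLA hxle
    · rw [hx']
      have hnn : FIRM.Nonneg (FIRM.step A c b (e (K + j)) x) := FIRM.step_nonneg _ _
      have h1 := hB b ustar mustar hopt _ (he0 (K + j)) (heH _) hμL x hxle
      have h2 := FIRM.Q_lower hl hs hopt (he0 (K + j)) hμL hnn
      have h3 : e (K + j) ≤ ε / r := by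
        rw [hesucc] at hlast
        rw [le_div_iff₀ hr0]
        linarith
      have hp := he0 (K + j)
      have hpH := heH (K + j)
      have h4 : e (K + j) ^ 2 ≤ H * (ε / r) := by rw [sq]; gcongr
      have h5 : e (K + j) ^ 3 ≤ H ^ 2 * (ε / r) := by
        have : e (K + j) ^ 3 = e (K + j) * e (K + j) ^ 2 := by ring
        rw [this, sq H, mul_assoc]
        gcongr
      have h6 : B * e (K + j) ^ 2 ≤ B * (H * (ε / r)) := by gcongr
      have h7 : (C₀ / (1 - r) + (B * H + 4 * H ^ 2) / r) * ε
          = C₀ / (1 - r) * ε + B * (H * (ε / r)) + 4 * (H ^ 2 * (ε / r)) := by ring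
      have h8 : 0 ≤ C₀ / (1 - r) * ε := by positivity
      have h9 : 0 ≤ B * (H * (ε / r)) := by positivity
      have h10 : 0 ≤ H ^ 2 * (ε / r) := by positivity
      rw [h7, abs_le]
      constructor <;> linarith
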